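/- For a finite simple graph $G$ let $\mathrm{Ind}(G)$ denote (the geometric realization of) its independence complex, the simplicial complex whose vertices are the vertices of $G$ and whose simplices are the nonempty independent sets of $G$. For $W\subseteq V(G)$ let $G[W]$ be the subgraph induced by $W$; for $W\subseteq W'\subseteq V(G)$ the inclusion $G[W]\subseteq G[W']$ induces an inclusion $\mathrm{Ind}(G[W])\hookrightarrow\mathrm{Ind}(G[W'])$. Theorem. Let $G$ be a finite simple graph and let $X,Y\subseteq V(G)$ be such that - $X\cup Y=V(G)$, - $\mathrm{Ind}(G[X\cap Y])$ is contractible (in particular nonempty), - every vertex of $X\setminus Y$ is adjacent to every vertex of $Y\setminus X$. Then for every point $p\in\mathrm{Ind}(G[X\cap Y])$ there is a homotopy equivalence $$e:\ \mathrm{Ind}(G)\ \xrightarrow{\ \simeq\ }\ \mathrm{Ind}(G[X])\vee\mathrm{Ind}(G[Y]),$$ where the wedge sum is formed by identifying the image of $p$ in $\mathrm{Ind}(G[X])$ with the image of $p$ in $\mathrm{Ind}(G[Y])$, and which is natural in the following sense: the composites of $e$ with the inclusions $\mathrm{Ind}(G[X])\hookrightarrow\mathrm{Ind}(G)$ and $\mathrm{Ind}(G[Y])\hookrightarrow\mathrm{Ind}(G)$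 are homotopic to the inclusions of the first and the second wedge summand, respectively. -/

import Mathlib

open scoped ContinuousMap

noncomputable section

universe u v

namespace SimpleGraph

/-- The independence complex `Ind(G)` of a graph `G`: its vertices are the vertices of `G` and its
simplices are the (nonempty, finite) independent sets of `G`. -/
def indComplex {V : Type u} (G : SimpleGraph V) : AbstractSimplicialComplex V where
  faces := {σ | σ.Nonempty ∧ G.IsIndepSet (σ : Set V)}
  isRelLowerSet_faces := fun σ hσ =>
    ⟨hσ.1, fun _τ hτσ hτ => ⟨hτ, hσ.2.mono (Finset.coe_subset.2 hτσ)⟩⟩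
  singleton_mem := fun w => ⟨Finset.singleton_nonempty w, by simp⟩

end SimpleGraph

/-- The geometric realization of an abstract simplicial complex on a finite vertex set, in
barycentric coordinates: the points of the standard simplex on the vertex set whose support is
contained in a face. It is a subspace of `ℝ^V`; as `V` is finite, this is the usual topology. -/
def AbstractSimplicialComplex.realization {V : Type u} [Finite V]
    (K : AbstractSimplicialComplex V) : Set (V → ℝ) :=
  {x | ∃ σ ∈ K.faces, (∀ w, 0 ≤ x w) ∧ (∀ w, w ∉ σ → x w = 0) ∧ ∑ w ∈ σ, x w = 1}

namespace SimpleGraph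

/-- The topological space `|Ind(G)|`, for a finite graph `G`. -/
abbrev IndSpace {V : Type u} [Finite V] (G : SimpleGraph V) : Type u :=
  G.indComplex.realization

theorem extend_mem_realization {V : Type u} {W : Type v} [Finite V] [Finite W]
    {H : SimpleGraph W} {G : SimpleGraph V} (φ : H ↪g G) (x : H.IndSpace) :
    Function.extend φ (x : W → ℝ) 0 ∈ G.indComplex.realization := by
  obtain ⟨x, σ, hσ, h0, hs, h1⟩ := x
  refine ⟨σ.map φ.toEmbedding, ⟨(Finset.map_nonempty).2 hσ.1, ?_⟩, ?_, ?_, ?_⟩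
  · intro a ha b hb hab
    simp only [Finset.coe_map, Set.mem_image] at ha hb
    obtain ⟨a, ha, rfl⟩ := ha
    obtain ⟨b, hb, rfl⟩ := hb
    have hne : a ≠ b := fun h => hab (by rw [h])
    exact fun h => hσ.2 ha hb hne (φ.map_adj_iff.1 h)
  · intro w
    by_cases hw : ∃ a, φ a = w
    · obtain ⟨a, rfl⟩ := hw
      rw [φ.injective.extend_apply]
      exact h0 a
    · rw [Function.extend_apply' _ _ _ hw]
      exact le_rfl
  · intro w hwσ
    by_cases hw : ∃ a, φ a = w
    · obtain ⟨a, rfl⟩ := hw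
      rw [φ.injective.extend_apply]
      exact hs a fun ha => hwσ (Finset.mem_map.2 ⟨a, ha, rfl⟩)
    · rw [Function.extend_apply' _ _ _ hw]
      rfl
  · refine (Finset.sum_map _ _ _).trans ((Finset.sum_congr rfl fun a _ => ?_).trans h1)
    exact φ.injective.extend_apply x 0 a

/-- The map `|Ind(H)| → |Ind(G)|` induced by the embedding of `H` as an induced subgraph of `G`:
barycentric coordinates are transported along the embedding and extended by zero. -/
def indMap {V : Type u} {W : Type v} [Finite V] [Finite W]
    {H : SimpleGraph W} {G : SimpleGraph V} (φ : H ↪g G) : C(H.IndSpace, G.IndSpace) where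
  toFun x := ⟨Function.extend φ (x : W → ℝ) 0, extend_mem_realization φ x⟩
  continuous_toFun := by
    refine Continuous.subtype_mk (continuous_pi fun w => ?_) _
    by_cases hw : ∃ a, φ a = w
    · obtain ⟨a, rfl⟩ := hw
      simp only [φ.injective.extend_apply]
      exact (continuous_apply a).comp continuous_subtype_val
    · simp only [Function.extend_apply' _ _ _ hw]
      exact continuous_const

end SimpleGraph

/-- The wedge sum of the pointed spaces `(A, a)` and `(B, b)`: the disjoint union of `A` and `B`
with `a` and `b` identified, with the quotient topology. -/
def Wedge {A : Type u} {B : Type v} (a : A) (b : B) : Type (max u v) :=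
  Quot fun s t : A ⊕ B => s = Sum.inl a ∧ t = Sum.inr b

namespace Wedge

instance {A : Type u} {B : Type v} [TopologicalSpace A] [TopologicalSpace B] (a : A) (b : B) :
    TopologicalSpace (Wedge a b) :=
  inferInstanceAs (TopologicalSpace (Quot _))

/-- The inclusion of the first wedge summand. -/
def inl {A : Type u} {B : Type v} [TopologicalSpace A] [TopologicalSpace B] (a : A) (b : B) :
    C(A, Wedge a b) where
  toFun x := Quot.mk _ (Sum.inl x)
  continuous_toFun := continuous_quot_mk.comp continuous_inl

/-- The inclusion of the second wedge summand. -/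
def inr {A : Type u} {B : Type v} [TopologicalSpace A] [TopologicalSpace B] (a : A) (b : B) :
    C(B, Wedge a b) where
  toFun y := Quot.mk _ (Sum.inr y)
  continuous_toFun := continuous_quot_mk.comp continuous_inr

end Wedge

end

/-! ### Absolute neighbourhood extensors, contractions and homotopy extension. -/

open Set Topology unitInterval

/-! No independent set meets both `X \ Y` and `Y \ X`, so `Ind(G)` is the union of the closed
subspaces `A = Ind(G[X])` and `B = Ind(G[Y])`, which meet in the contractible `C = Ind(G[X ∩ Y])`.
Contract `C` to `p` keeping `p` fixed (`IsANE.exists_pointed_contraction`), and extend this to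
deformations of `A` and of `B` (`IsANE.exists_homotopy_extension`). Their end maps send `C` to `p`,
so they glue to `e : Ind(G) → A ∨ B`. The homotopy inverse is given by the two inclusions; the
deformations, glued along `C` in `Ind(G)` and at `p` in the wedge, join both composites to the
identities (`exists_homotopyEquiv_wedge`). Both extension results rest on `isANE_indSpace`: an
explicit retraction of a neighbourhood in `ℝ^V`, followed by Tietze's theorem, extends maps into the
complex. -/

/-- A space `Y` is an absolute neighbourhood extensor (for normal spaces) if every continuous map
into `Y` from a closed subset of a normal space extends continuously to an open neighbourhood. -/
def IsANE (Y : Type u) [TopologicalSpace Y] : Prop :=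
  ∀ (Z : Type u) [TopologicalSpace Z] [NormalSpace Z] (D : Set Z), IsClosed D →
    ∀ f : Z → Y, ContinuousOn f D →
      ∃ U : Set Z, IsOpen U ∧ D ⊆ U ∧ ∃ g : Z → Y, ContinuousOn g U ∧ EqOn g f D

theorem exists_continuous_unitInterval {Z : Type u} [TopologicalSpace Z] [NormalSpace Z]
    {D U : Set Z} (hD : IsClosed D) (hU : IsOpen U) (hDU : D ⊆ U) :
    ∃ φ : C(Z, I), (∀ z ∈ D, φ z = 1) ∧ ∀ z ∉ U, φ z = 0 := by
  obtain ⟨f, h0, h1, hf⟩ := exists_continuous_zero_one_of_isClosed hU.isClosed_compl hD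
    (disjoint_compl_left_iff_subset.2 hDU)
  exact ⟨⟨fun z => ⟨f z, hf z⟩, f.continuous.subtype_mk _⟩, fun z hz => Subtype.ext (h1 hz),
    fun z hz => Subtype.ext (h0 hz)⟩

/-- A contractible absolute neighbourhood extensor is an absolute extensor. -/
theorem IsANE.exists_extension {Y : Type u} [TopologicalSpace Y] (hY : IsANE Y)
    [ContractibleSpace Y] {Z : Type u} [TopologicalSpace Z] [NormalSpace Z] {D : Set Z}
    (hD : IsClosed D) {f : Z → Y} (hf : ContinuousOn f D) :
    ∃ g : C(Z, Y), EqOn g f D := by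
  classical
  obtain ⟨y, ⟨K⟩⟩ := id_nullhomotopic Y
  obtain ⟨U, hU, hDU, g, hg, hgf⟩ := hY Z D hD f hf
  obtain ⟨V, hV, hDV, hVU⟩ := normal_exists_closure_subset hD hU hDU
  obtain ⟨φ, h1, h0⟩ := exists_continuous_unitInterval hD hV hDV
  -- The local extension `g` is kept on `D` and pushed along the contraction to the constant `y`
  -- before it leaves `U`.
  let k : Z → Y := fun z => if z ∈ U then K (σ (φ z), g z) else y
  have hk : Continuous k := by
    rw [← continuousOn_univ]
    have hcov : (univ : Set Z) = closure V ∪ Vᶜ := by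
      rw [eq_comm, eq_univ_iff_forall]
      intro z
      by_cases hz : z ∈ V
      · exact Or.inl (subset_closure hz)
      · exact Or.inr hz
    rw [hcov]
    refine ContinuousOn.union_of_isClosed ?_ ?_ isClosed_closure hV.isClosed_compl
    · have : ContinuousOn (fun z => K (σ (φ z), g z)) (closure V) :=
        K.continuous.comp_continuousOn
          ((unitInterval.continuous_symm.comp φ.continuous).continuousOn.prodMk (hg.mono hVU))
      exact this.congr fun z hz => if_pos (hVU hz)
    · refine (continuousOn_const (c := y)).congr fun z hz => ?_
      simp only [k]
      split_ifs
      · rw [h0 z hz, unitInterval.symm_zero]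
        exact K.map_one_left _
      · rfl
  refine ⟨⟨k, hk⟩, fun z hz => ?_⟩
  change k z = f z
  simp only [k]
  rw [if_pos (hDU hz), h1 z hz, unitInterval.symm_one, hgf hz]
  exact K.map_zero_left _

/-- A contractible compact Hausdorff absolute neighbourhood extensor contracts to each of its
points relative to that point. -/
theorem IsANE.exists_pointed_contraction {Y : Type u} [TopologicalSpace Y] (hY : IsANE Y)
    [ContractibleSpace Y] [CompactSpace Y] [T2Space Y] (p : Y) :
    ∃ H : C(I × Y, Y), (∀ y, H (0, y) = y) ∧ (∀ y, H (1, y) = p) ∧ ∀ t, H (t, p) = p := by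
  -- The desired values on three sides of `I × Y`; they agree at `(0, p)`.
  let f : I × Y → Y := fun z => if z.1 = 0 then z.2 else p
  let D₀ : Set (I × Y) := Prod.fst ⁻¹' {0}
  let D₁ : Set (I × Y) := Prod.fst ⁻¹' {1} ∪ Prod.snd ⁻¹' {p}
  have hD₀ : IsClosed D₀ := isClosed_singleton.preimage continuous_fst
  have hD₁ : IsClosed D₁ := (isClosed_singleton.preimage continuous_fst).union
    (isClosed_singleton.preimage continuous_snd)
  have hf₀ : ContinuousOn f D₀ := continuous_snd.continuousOn.congr fun z hz => if_pos hz
  have hp : ∀ z ∈ D₁, f z = p := by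
    rintro ⟨t, y⟩ (hz | hz)
    · have ht : t = 1 := hz
      simp [f, ht]
    · have hy : y = p := hz
      simp [f, hy]
  have hf₁ : ContinuousOn f D₁ := continuousOn_const.congr hp
  obtain ⟨H, hH⟩ := hY.exists_extension (hD₀.union hD₁) (hf₀.union_of_isClosed hf₁ hD₀ hD₁)
  refine ⟨H, fun y => ?_, fun y => ?_, fun t => ?_⟩
  · exact (hH (Or.inl rfl)).trans (if_pos rfl)
  · exact (hH (Or.inr (Or.inl rfl))).trans (hp _ (Or.inl rfl))
  · exact (hH (Or.inr (Or.inr rfl))).trans (hp _ (Or.inr rfl))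

/-- Borsuk's homotopy extension theorem, for homotopies that start at the identity. -/
theorem IsANE.exists_homotopy_extension {A C : Type u} [TopologicalSpace A] [TopologicalSpace C]
    (hA : IsANE A) [CompactSpace A] [T2Space A] {i : C → A} (hi : IsClosedEmbedding i)
    (H : C(I × C, C)) (hH : ∀ c, H (0, c) = c) :
    ∃ F : C(I × A, A), (∀ x, F (0, x) = x) ∧ ∀ t c, F (t, i c) = i (H (t, c)) := by
  rcases isEmpty_or_nonempty C with hC | hC
  · exact ⟨ContinuousMap.snd, fun _ => rfl, fun _ c => isEmptyElim c⟩
  let f : I × A → A := fun z => if z.1 = 0 then z.2 else i (H (z.1, Function.invFun i z.2))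
  have hfi : ∀ t c, f (t, i c) = i (H (t, c)) := by
    intro t c
    simp only [f, Function.leftInverse_invFun hi.injective c]
    split_ifs with ht
    · rw [ht, hH]
    · rfl
  let D₀ : Set (I × A) := Prod.fst ⁻¹' {0}
  let D₁ : Set (I × A) := Prod.map id i '' univ
  have hemb : IsClosedEmbedding (Prod.map (id : I → I) i) := IsClosedEmbedding.id.prodMap hi
  have hD₀ : IsClosed D₀ := isClosed_singleton.preimage continuous_fst
  have hD₁ : IsClosed D₁ := hemb.isClosedMap _ isClosed_univ
  have hf₀ : ContinuousOn f D₀ := continuous_snd.continuousOn.congr fun z hz => if_pos hz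
  have hf₁ : ContinuousOn f D₁ := by
    rw [hemb.isInducing.continuousOn_image_iff]
    exact (hi.continuous.comp H.continuous).continuousOn.congr fun z _ => hfi z.1 z.2
  obtain ⟨U, hU, hDU, g, hg, hgf⟩ :=
    hA (I × A) _ (hD₀.union hD₁) f (hf₀.union_of_isClosed hf₁ hD₀ hD₁)
  -- As `I` is compact, `U` contains a tube `I × N` around `I × i(C)`.
  obtain ⟨v, N, -, hN, hv, hiN, hvN⟩ := generalized_tube_lemma (isCompact_univ (X := I))
    hi.isClosed_range.isCompact hU (by
      rintro ⟨t, _⟩ ⟨-, c, rfl⟩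
      exact hDU (Or.inr ⟨(t, c), trivial, rfl⟩))
  obtain ⟨φ, h1, h0⟩ := exists_continuous_unitInterval hi.isClosed_range hN hiN
  -- Slowing time by `φ` keeps the path of every point in `U`: points outside `N` never leave time
  -- `0`.
  have hmem : ∀ z : I × A, (z.1 * φ z.2, z.2) ∈ U := by
    rintro ⟨t, x⟩
    by_cases hx : x ∈ N
    · exact hvN ⟨hv trivial, hx⟩
    · refine hDU (Or.inl ?_)
      change t * φ x = 0
      rw [h0 x hx, mul_zero]
  refine ⟨⟨fun z => g (z.1 * φ z.2, z.2), hg.comp_continuous (by fun_prop) hmem⟩,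
    fun x => ?_, fun t c => ?_⟩
  · change g (0 * φ x, x) = x
    rw [zero_mul, hgf (Or.inl rfl)]
    exact if_pos rfl
  · change g (t * φ (i c), i c) = _
    rw [h1 _ ⟨c, rfl⟩, mul_one, ← hfi]
    exact hgf (Or.inr ⟨(t, c), trivial, rfl⟩)

/-! ### Gluing homotopies, and the wedge decomposition. -/

/-- Two homotopies that respect the identifications of a quotient of a disjoint union descend to
the quotient. -/
theorem Topology.IsQuotientMap.exists_homotopy_sumElim {A B Q T : Type*} [TopologicalSpace A]
    [TopologicalSpace B] [TopologicalSpace Q] [TopologicalSpace T] {q : C(A ⊕ B, Q)}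
    (hq : IsQuotientMap q) (f : C(I × A, T)) (g : C(I × B, T))
    (hfg : ∀ t s s', q s = q s' →
      Sum.elim (fun x => f (t, x)) (fun y => g (t, y)) s =
        Sum.elim (fun x => f (t, x)) (fun y => g (t, y)) s') :
    ∃ k : C(I × Q, T), (∀ t x, k (t, q (Sum.inl x)) = f (t, x)) ∧
      ∀ t y, k (t, q (Sum.inr y)) = g (t, y) := by
  -- Currying turns homotopies into maps to the path space, which descend along `q` itself; no
  -- quotient property of `I × q` is needed.
  let c : C(A ⊕ B, C(I, T)) :=
    ⟨Sum.elim (f.comp ContinuousMap.prodSwap).curry (g.comp ContinuousMap.prodSwap).curry,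
      (ContinuousMap.continuous _).sumElim (ContinuousMap.continuous _)⟩
  have hc : ∀ s t, c s t = Sum.elim (fun x => f (t, x)) (fun y => g (t, y)) s := by
    rintro (x | y) t <;> rfl
  have hcq : Function.FactorsThrough c q := fun s s' hs => by
    ext t
    rw [hc, hc, hfg t s s' hs]
  have hl : ∀ t s, hq.lift c hcq (q s) t = c s t := fun t s =>
    DFunLike.congr_fun (DFunLike.congr_fun (hq.lift_comp c hcq) s) t
  exact ⟨(hq.lift c hcq).uncurry.comp ContinuousMap.prodSwap, fun t x => hl t (Sum.inl x),
    fun t y => hl t (Sum.inr y)⟩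

/-- A space that is the union of two closed subspaces `A` and `B` whose intersection `C` is
contractible is homotopy equivalent to the wedge sum of `A` and `B`. -/
theorem exists_homotopyEquiv_wedge {K A B C : Type u} [TopologicalSpace K] [T2Space K]
    [TopologicalSpace A] [CompactSpace A] [T2Space A] [TopologicalSpace B] [CompactSpace B]
    [T2Space B] [TopologicalSpace C] [CompactSpace C] [T2Space C] [ContractibleSpace C]
    (hA : IsANE A) (hB : IsANE B) (hC : IsANE C) (i : C(C, A)) (j : C(C, B)) (a : C(A, K))
    (b : C(B, K)) (hi : Function.Injective i) (hj : Function.Injective j)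
    (ha : Function.Injective a) (hb : Function.Injective b) (hij : ∀ c, a (i c) = b (j c))
    (hpull : ∀ x y, a x = b y → ∃ c, i c = x ∧ j c = y)
    (hcov : ∀ z, (∃ x, a x = z) ∨ ∃ y, b y = z) (p : C) :
    ∃ e : ContinuousMap.HomotopyEquiv K (Wedge (i p) (j p)),
      (e.toFun.comp a).Homotopic (Wedge.inl _ _) ∧
        (e.toFun.comp b).Homotopic (Wedge.inr _ _) := by
  obtain ⟨H, H0, H1, Hp⟩ := hC.exists_pointed_contraction p
  obtain ⟨F, F0, Fi⟩ := hA.exists_homotopy_extension (i.continuous.isClosedEmbedding hi) H H0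
  obtain ⟨F', F0', Fj⟩ := hB.exists_homotopy_extension (j.continuous.isClosedEmbedding hj) H H0
  have hw : Wedge.inl (i p) (j p) (i p) = Wedge.inr (i p) (j p) (j p) := Quot.sound ⟨rfl, rfl⟩
  let q : C(A ⊕ B, K) := ⟨Sum.elim a b, a.continuous.sumElim b.continuous⟩
  have hq : IsQuotientMap q := by
    refine q.continuous.isClosedMap.isQuotientMap q.continuous fun z => ?_
    rcases hcov z with ⟨x, hx⟩ | ⟨y, hy⟩
    exacts [⟨Sum.inl x, hx⟩, ⟨Sum.inr y, hy⟩]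
  let r : C(A ⊕ B, Wedge (i p) (j p)) := ⟨Quot.mk _, continuous_quot_mk⟩
  have hr : IsQuotientMap r := isQuotientMap_quot_mk
  -- both quotients of `A ⊕ B` identify points only through `i` and `j`
  have q_ind : ∀ {T : Type u} (f : A → T) (g : B → T), (∀ c, f (i c) = g (j c)) →
      ∀ s s', q s = q s' → Sum.elim f g s = Sum.elim f g s' := by
    rintro T f g hfg (x | y) (x' | y') h
    · exact congrArg f (ha h)
    · obtain ⟨c, rfl, rfl⟩ := hpull _ _ h
      exact hfg c
    · obtain ⟨c, rfl, rfl⟩ := hpull _ _ h.symm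
      exact (hfg c).symm
    · exact congrArg g (hb h)
  have r_ind : ∀ {T : Type u} (f : A → T) (g : B → T), f (i p) = g (j p) →
      ∀ s s', r s = r s' → Sum.elim f g s = Sum.elim f g s' := by
    intro T f g hfg s s' h
    let l : Wedge (i p) (j p) → T := Quot.lift (Sum.elim f g) (by
      rintro _ _ ⟨rfl, rfl⟩
      exact hfg)
    exact congrArg l h
  -- A single map is glued as a homotopy constant in time and later read off at time `0`.
  obtain ⟨e, ea, eb⟩ := hq.exists_homotopy_sumElim
    ((Wedge.inl (i p) (j p)).comp (F.comp ((ContinuousMap.const _ 1).prodMk ContinuousMap.snd)))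
    ((Wedge.inr (i p) (j p)).comp (F'.comp ((ContinuousMap.const _ 1).prodMk ContinuousMap.snd)))
    fun t => q_ind _ _ fun c => by
      change Wedge.inl (i p) (j p) (F (1, i c)) = Wedge.inr (i p) (j p) (F' (1, j c))
      rw [Fi, Fj, H1, hw]
  obtain ⟨g, ga, gb⟩ := hr.exists_homotopy_sumElim (a.comp ContinuousMap.snd)
    (b.comp ContinuousMap.snd) fun t => r_ind _ _ (hij p)
  obtain ⟨E, Ea, Eb⟩ := hq.exists_homotopy_sumElim (a.comp F) (b.comp F')
    fun t => q_ind _ _ fun c => by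
      change a (F (t, i c)) = b (F' (t, j c))
      rw [Fi, Fj, hij]
  -- In the wedge the deformations agree only at the base point, so the contraction must fix `p` at
  -- all times.
  obtain ⟨E', Ea', Eb'⟩ := hr.exists_homotopy_sumElim ((Wedge.inl (i p) (j p)).comp F)
    ((Wedge.inr (i p) (j p)).comp F') fun t => r_ind _ _ (by
      change Wedge.inl (i p) (j p) (F (t, i p)) = Wedge.inr (i p) (j p) (F' (t, j p))
      rw [Fi, Fj, Hp, hw])
  let e₁ : C(K, Wedge (i p) (j p)) := e.comp ((ContinuousMap.const _ 0).prodMk (ContinuousMap.id _))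
  let g₁ : C(Wedge (i p) (j p), K) := g.comp ((ContinuousMap.const _ 0).prodMk (ContinuousMap.id _))
  have e₁a : ∀ x, e₁ (a x) = Wedge.inl (i p) (j p) (F (1, x)) := ea 0
  have e₁b : ∀ y, e₁ (b y) = Wedge.inr (i p) (j p) (F' (1, y)) := eb 0
  have g₁a : ∀ x, g₁ (Wedge.inl (i p) (j p) x) = a x := ga 0
  have g₁b : ∀ y, g₁ (Wedge.inr (i p) (j p) y) = b y := gb 0
  have hge : (g₁.comp e₁).Homotopic (ContinuousMap.id K) := by
    refine ContinuousMap.Homotopic.symm ⟨⟨E, fun z => ?_, fun z => ?_⟩⟩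
    · obtain ⟨x | y, rfl⟩ := hq.surjective z
      · exact (Ea 0 x).trans (congrArg a (F0 x))
      · exact (Eb 0 y).trans (congrArg b (F0' y))
    · obtain ⟨x | y, rfl⟩ := hq.surjective z
      · exact (Ea 1 x).trans ((congrArg g₁ (e₁a x)).trans (g₁a _)).symm
      · exact (Eb 1 y).trans ((congrArg g₁ (e₁b y)).trans (g₁b _)).symm
  have heg : (e₁.comp g₁).Homotopic (ContinuousMap.id _) := by
    refine ContinuousMap.Homotopic.symm ⟨⟨E', fun z => ?_, fun z => ?_⟩⟩
    · obtain ⟨x | y, rfl⟩ := hr.surjective z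
      · exact (Ea' 0 x).trans (congrArg (Wedge.inl (i p) (j p)) (F0 x))
      · exact (Eb' 0 y).trans (congrArg (Wedge.inr (i p) (j p)) (F0' y))
    · obtain ⟨x | y, rfl⟩ := hr.surjective z
      · exact (Ea' 1 x).trans ((congrArg e₁ (g₁a x)).trans (e₁a x)).symm
      · exact (Eb' 1 y).trans ((congrArg e₁ (g₁b y)).trans (e₁b y)).symm
  refine ⟨⟨e₁, g₁, hge, heg⟩, ContinuousMap.Homotopic.symm ?_, ContinuousMap.Homotopic.symm ?_⟩
  · exact ⟨⟨(Wedge.inl (i p) (j p)).comp F, fun x => congrArg (Wedge.inl (i p) (j p)) (F0 x),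
      fun x => (e₁a x).symm⟩⟩
  · exact ⟨⟨(Wedge.inr (i p) (j p)).comp F', fun y => congrArg (Wedge.inr (i p) (j p)) (F0' y),
      fun y => (e₁b y).symm⟩⟩

/-! ### Independence complexes are compact absolute neighbourhood extensors. -/

namespace SimpleGraph

variable {V : Type u} (G : SimpleGraph V)

/-- The support of `x` can serve as the face, which leaves closed conditions on the coordinates. -/
theorem mem_realization_iff [Fintype V] (x : V → ℝ) : x ∈ G.indComplex.realization ↔
    (∀ w, 0 ≤ x w) ∧ (∀ u v, G.Adj u v → x u = 0 ∨ x v = 0) ∧ ∑ w, x w = 1 := by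
  constructor
  · rintro ⟨τ, hτ, h0, hs, h1⟩
    refine ⟨h0, fun u v huv => ?_, ?_⟩
    · by_contra! h
      have hu : u ∈ τ := by_contra fun h' => h.1 (hs u h')
      have hv : v ∈ τ := by_contra fun h' => h.2 (hs v h')
      exact hτ.2 hu hv huv.ne huv
    · rw [← h1]
      exact (Finset.sum_subset (Finset.subset_univ _) fun w _ hw => hs w hw).symm
  · rintro ⟨h0, hadj, h1⟩
    have hsum : ∑ w with x w ≠ 0, x w = 1 := by rw [Finset.sum_filter_ne_zero, h1]
    refine ⟨Finset.univ.filter fun w => x w ≠ 0, ⟨?_, ?_⟩, h0, fun w hw => by simpa using hw, hsum⟩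
    · by_contra h
      rw [Finset.not_nonempty_iff_eq_empty] at h
      simp [h] at hsum
    · intro u hu v hv _ huv
      simp only [ne_eq, Finset.coe_filter, Finset.mem_univ, true_and, mem_ofPred_eq] at hu hv
      exact (hadj u v huv).elim hu hv

instance [Finite V] : CompactSpace G.IndSpace := by
  have := Fintype.ofFinite V
  rw [← isCompact_iff_compactSpace]
  have hcl : IsClosed G.indComplex.realization := by
    have : G.indComplex.realization = {x | ∀ w, 0 ≤ x w} ∩
        ({x | ∀ u v, G.Adj u v → x u = 0 ∨ x v = 0} ∩ {x | ∑ w, x w = 1}) :=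
      Set.ext fun x => G.mem_realization_iff x
    rw [this]
    refine IsClosed.inter ?_ (IsClosed.inter ?_ ?_)
    · simp only [ofPred_forall]
      exact isClosed_iInter fun w => isClosed_le continuous_const (continuous_apply w)
    · simp only [ofPred_forall, ofPred_or]
      exact isClosed_iInter fun u => isClosed_iInter fun v => isClosed_iInter fun _ =>
        (isClosed_eq (continuous_apply u) continuous_const).union
          (isClosed_eq (continuous_apply v) continuous_const)
    · exact isClosed_eq (by fun_prop) continuous_const
  refine (isCompact_univ_pi fun _ : V => isCompact_Icc (a := (0 : ℝ)) (b := 1)).of_isClosed_subset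
    hcl fun x hx w _ => ?_
  obtain ⟨h0, -, h1⟩ := (G.mem_realization_iff x).1 hx
  exact ⟨h0 w, h1 ▸ Finset.single_le_sum (fun u _ => h0 u) (Finset.mem_univ w)⟩

open Classical in
/-- The coordinates of `x`, lowered by an amount that is at least the smaller one of
the coordinates of each pair of adjacent vertices, and cut off at zero. -/
noncomputable def truncate [Fintype V] (x : V → ℝ) (w : V) : ℝ :=
  max 0 (x w - ∑ u, ∑ v, if G.Adj u v then max 0 (min (x u) (x v)) else 0)

theorem continuous_truncate [Fintype V] : Continuous G.truncate := by
  refine continuous_pi fun w => ?_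
  refine continuous_const.max ((continuous_apply w).sub ?_)
  refine continuous_finsetSum _ fun u _ => continuous_finsetSum _ fun v _ => ?_
  split_ifs
  · fun_prop
  · exact continuous_const

theorem truncate_eq_zero_or [Fintype V] (x : V → ℝ) {u v : V} (h : G.Adj u v) :
    G.truncate x u = 0 ∨ G.truncate x v = 0 := by
  classical
  have h0 : ∀ u v, 0 ≤ if G.Adj u v then max 0 (min (x u) (x v)) else 0 := by
    intro u v
    split_ifs
    · exact le_max_left _ _
    · exact le_rfl
  have hle : min (x u) (x v) ≤ ∑ u, ∑ v, if G.Adj u v then max 0 (min (x u) (x v)) else 0 := by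
    calc min (x u) (x v) ≤ if G.Adj u v then max 0 (min (x u) (x v)) else 0 := by
          rw [if_pos h]
          exact le_max_right _ _
      _ ≤ ∑ v, if G.Adj u v then max 0 (min (x u) (x v)) else 0 :=
          Finset.single_le_sum (f := fun v => if G.Adj u v then max 0 (min (x u) (x v)) else 0)
            (fun v _ => h0 u v) (Finset.mem_univ v)
      _ ≤ _ := Finset.single_le_sum
            (f := fun u => ∑ v, if G.Adj u v then max 0 (min (x u) (x v)) else 0)
            (fun u _ => Finset.sum_nonneg fun v _ => h0 u v) (Finset.mem_univ u)
  rcases min_le_iff.1 hle with h | h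
  · exact Or.inl (max_eq_left (sub_nonpos.2 h))
  · exact Or.inr (max_eq_left (sub_nonpos.2 h))

theorem truncate_of_mem [Fintype V] {x : V → ℝ} (hx : x ∈ G.indComplex.realization) :
    G.truncate x = x := by
  classical
  obtain ⟨h0, hadj, -⟩ := (G.mem_realization_iff x).1 hx
  have : ∑ u, ∑ v, (if G.Adj u v then max 0 (min (x u) (x v)) else 0) = 0 := by
    refine Finset.sum_eq_zero fun u _ => Finset.sum_eq_zero fun v _ => ?_
    split_ifs with h
    · refine max_eq_left (min_le_iff.2 ?_)
      exact (hadj u v h).imp Eq.le Eq.le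
    · rfl
  funext w
  rw [truncate, this, sub_zero, max_eq_right (h0 w)]

theorem div_sum_truncate_mem [Fintype V] {x : V → ℝ} (hx : 0 < ∑ w, G.truncate x w) :
    (fun w => G.truncate x w / ∑ w, G.truncate x w) ∈ G.indComplex.realization := by
  refine (G.mem_realization_iff _).2 ⟨fun w => div_nonneg (le_max_left _ _) hx.le,
    fun u v h => ?_, ?_⟩
  · exact (G.truncate_eq_zero_or x h).imp (fun h => by rw [h, zero_div])
      fun h => by rw [h, zero_div]
  · rw [← Finset.sum_div, div_self hx.ne']

/-- The independence complex is a neighbourhood retract in `ℝ^V`, so it is an absolute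
neighbourhood extensor. -/
theorem isANE_indSpace [Finite V] : IsANE G.IndSpace := by
  have := Fintype.ofFinite V
  intro Z _ _ D hD f hf
  obtain ⟨g, hg⟩ := ContinuousMap.exists_restrict_eq hD
    (⟨fun z : D => (f z : V → ℝ), continuous_subtype_val.comp hf.domRestrict⟩ : C(D, V → ℝ))
  have hgf : ∀ z ∈ D, g z = f z := fun z hz => DFunLike.congr_fun hg (⟨z, hz⟩ : D)
  have hcont : Continuous fun z => G.truncate (g z) := G.continuous_truncate.comp g.continuous
  have hsum : Continuous fun z => ∑ w, G.truncate (g z) w :=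
    continuous_finsetSum _ fun w _ => (continuous_apply w).comp hcont
  have hD1 : ∀ z ∈ D, ∑ w, G.truncate (g z) w = 1 := by
    intro z hz
    rw [hgf z hz, G.truncate_of_mem (f z).2]
    exact ((G.mem_realization_iff _).1 (f z).2).2.2
  -- Truncating and normalizing the Tietze extension lands in the complex where the sum is positive;
  -- `f z` is a dummy value elsewhere.
  refine ⟨{z | 0 < ∑ w, G.truncate (g z) w}, isOpen_lt continuous_const hsum,
    fun z hz => ?_, fun z => if h : 0 < ∑ w, G.truncate (g z) w then
      ⟨_, G.div_sum_truncate_mem h⟩ else f z, ?_, fun z hz => ?_⟩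
  · rw [mem_ofPred_eq, hD1 z hz]
    exact one_pos
  · rw [IsInducing.subtypeVal.continuousOn_iff]
    refine ContinuousOn.congr (f := fun z w => G.truncate (g z) w / ∑ w, G.truncate (g z) w) ?_ ?_
    · exact continuousOn_pi.2 fun w => ((continuous_apply w).comp hcont).continuousOn.div
        hsum.continuousOn fun z hz => ne_of_gt hz
    · intro z hz
      simp only [Function.comp_apply]
      rw [dif_pos (show 0 < ∑ w, G.truncate (g z) w from hz)]
  · have h : 0 < ∑ w, G.truncate (g z) w := by
      rw [hD1 z hz]
      exact one_pos
    simp only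
    rw [dif_pos h]
    refine Subtype.ext (funext fun w => ?_)
    simp only [hD1 z hz, div_one]
    rw [hgf z hz, G.truncate_of_mem (f z).2]

/-! ### Maps induced by induced subgraphs, and the theorem. -/

theorem indMap_apply {W : Type v} [Finite V] [Finite W] {H : SimpleGraph W} {G : SimpleGraph V}
    (φ : H ↪g G) (x : H.IndSpace) (w : W) : (indMap φ x : V → ℝ) (φ w) = (x : W → ℝ) w :=
  φ.injective.extend_apply _ _ _

theorem indMap_apply_of_notMem_range {W : Type v} [Finite V] [Finite W] {H : SimpleGraph W}
    {G : SimpleGraph V} (φ : H ↪g G) (x : H.IndSpace) {v : V} (hv : v ∉ range φ) :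
    (indMap φ x : V → ℝ) v = 0 :=
  Function.extend_apply' _ _ _ hv

theorem indMap_injective {W : Type v} [Finite V] [Finite W] {H : SimpleGraph W}
    {G : SimpleGraph V} (φ : H ↪g G) : Function.Injective (indMap φ) := by
  intro x y h
  refine Subtype.ext (funext fun w => ?_)
  rw [← indMap_apply φ x, h, indMap_apply]

theorem indMap_comp {W : Type v} {U : Type*} [Finite V] [Finite W] [Finite U] {H : SimpleGraph W}
    {L : SimpleGraph U} {G : SimpleGraph V} (φ : H ↪g G) (ψ : L ↪g H) (x : L.IndSpace) :
    indMap φ (indMap ψ x) = indMap (φ.comp ψ) x := by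
  refine Subtype.ext (funext fun v => ?_)
  by_cases hv : v ∈ range φ
  · obtain ⟨w, rfl⟩ := hv
    rw [indMap_apply]
    by_cases hw : w ∈ range ψ
    · obtain ⟨u, rfl⟩ := hw
      rw [indMap_apply]
      exact (indMap_apply (φ.comp ψ) x u).symm
    · rw [indMap_apply_of_notMem_range ψ x hw, indMap_apply_of_notMem_range]
      rintro ⟨u, hu⟩
      exact hw ⟨u, φ.injective hu⟩
  · rw [indMap_apply_of_notMem_range φ _ hv, indMap_apply_of_notMem_range]
    rintro ⟨u, hu⟩
    exact hv ⟨ψ u, hu⟩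

theorem mem_range_indMap_induce_iff [Finite V] (X : Set V) (z : G.IndSpace) :
    z ∈ range (indMap (Embedding.induce (G := G) X)) ↔ ∀ v ∉ X, (z : V → ℝ) v = 0 := by
  classical
  have := Fintype.ofFinite V
  constructor
  · rintro ⟨x, rfl⟩ v hv
    refine indMap_apply_of_notMem_range _ _ ?_
    rintro ⟨w, rfl⟩
    exact hv w.2
  · intro hz
    obtain ⟨h0, hadj, h1⟩ := (G.mem_realization_iff _).1 z.2
    refine ⟨⟨fun w => (z : V → ℝ) w, ((G.induce X).mem_realization_iff _).2
      ⟨fun w => h0 w, fun u v huv => hadj u v huv, ?_⟩⟩, Subtype.ext (funext fun v => ?_)⟩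
    · rw [← h1]
      refine Finset.sum_of_injOn Subtype.val Subtype.val_injective.injOn (by simp)
        (fun v _ hv => hz v fun hvX => hv ⟨⟨v, hvX⟩, by simp, rfl⟩) fun _ _ => rfl
    · by_cases hv : v ∈ X
      · exact indMap_apply (Embedding.induce X) _ (⟨v, hv⟩ : X)
      · rw [hz v hv]
        refine indMap_apply_of_notMem_range _ _ ?_
        rintro ⟨w, rfl⟩
        exact hv w.2

end SimpleGraph

open SimpleGraph in
theorem mainTheorem5 {V : Type*} [Finite V] (G : SimpleGraph V) (X Y : Set V)
    (hXY : X ∪ Y = Set.univ)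
    (hcontr : ContractibleSpace (G.induce (X ∩ Y)).IndSpace)
    (hadj : ∀ x ∈ X \ Y, ∀ y ∈ Y \ X, G.Adj x y)
    (p : (G.induce (X ∩ Y)).IndSpace) :
    ∃ e : G.IndSpace ≃ₕ
        Wedge (SimpleGraph.indMap (G.induceHomOfLE (Set.inter_subset_left : X ∩ Y ⊆ X)) p)
          (SimpleGraph.indMap (G.induceHomOfLE (Set.inter_subset_right : X ∩ Y ⊆ Y)) p),
      (e.toFun.comp (SimpleGraph.indMap (SimpleGraph.Embedding.induce X))).Homotopic
          (Wedge.inl _ _) ∧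
        (e.toFun.comp (SimpleGraph.indMap (SimpleGraph.Embedding.induce Y))).Homotopic
          (Wedge.inr _ _) := by
  have hL : ∀ c, indMap (Embedding.induce (G := G) X) (indMap (G.induceHomOfLE
      (inter_subset_left : X ∩ Y ⊆ X)) c) = indMap (Embedding.induce (X ∩ Y)) c :=
    fun c => indMap_comp _ _ c
  have hR : ∀ c, indMap (Embedding.induce (G := G) Y) (indMap (G.induceHomOfLE
      (inter_subset_right : X ∩ Y ⊆ Y)) c) = indMap (Embedding.induce (X ∩ Y)) c :=
    fun c => indMap_comp _ _ c
  refine exists_homotopyEquiv_wedge (isANE_indSpace _) (isANE_indSpace _) (isANE_indSpace _) _ _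
    _ _ (indMap_injective _) (indMap_injective _) (indMap_injective _) (indMap_injective _)
    (fun c => (hL c).trans (hR c).symm) (fun x y hxy => ?_) (fun z => ?_) p
  · have hx := (G.mem_range_indMap_induce_iff X _).1 ⟨x, rfl⟩
    have hy := (G.mem_range_indMap_induce_iff Y _).1 ⟨y, rfl⟩
    rw [← hxy] at hy
    obtain ⟨c, hc⟩ := (G.mem_range_indMap_induce_iff (X ∩ Y) (indMap (Embedding.induce X) x)).2
      fun v hv => by
        by_cases hvX : v ∈ X
        · exact hy v fun hvY => hv ⟨hvX, hvY⟩
        · exact hx v hvX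
    exact ⟨c, indMap_injective _ ((hL c).trans hc),
      indMap_injective _ ((hR c).trans (hc.trans hxy))⟩
  · change z ∈ range (indMap (Embedding.induce (G := G) X)) ∨
      z ∈ range (indMap (Embedding.induce (G := G) Y))
    rw [mem_range_indMap_induce_iff, mem_range_indMap_induce_iff]
    -- Otherwise the support contains some `v ∉ X` and `w ∉ Y`, which are adjacent.
    by_contra! h
    obtain ⟨⟨v, hvX, hv⟩, w, hwY, hw⟩ := h
    have := Fintype.ofFinite V
    have hcover : ∀ u, u ∈ X ∨ u ∈ Y := fun u => hXY.ge (mem_univ u)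
    have hwv : G.Adj w v := hadj w ⟨(hcover w).resolve_right hwY, hwY⟩ v
      ⟨(hcover v).resolve_left hvX, hvX⟩
    exact (((G.mem_realization_iff _).1 z.2).2.1 w v hwv).elim hw hv
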